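/- Let $\mathbb{D}=\{z\in\mathbb{C}:|z|<1\}$. For $0<\lambda\le 1$ let $\mathcal{U}(\lambda)$ be the class of functions $f$ analytic in $\mathbb{D}$ with $f(0)=0$, $f'(0)=1$, $f(z)\ne 0$ for $z\in\mathbb{D}\setminus\{0\}$ and $$\left|\left(\frac{z}{f(z)}\right)^2 f'(z)-1\right|<\lambda\qquad(z\in\mathbb{D}),$$ where the expression inside the modulus is given its limit value $0$ at $z=0$, and let $\mathcal{U}_2(\lambda)=\{f\in\mathcal{U}(\lambda): f''(0)=0\}$. Theorem 6. Let $0<\lambda\le\frac12$, let $H\in\mathcal{U}_2(\lambda)$, let $G$ be analytic in $\mathbb{D}$, and let $F=H+\overline{G}$. Suppose that the dilatation $\omega=G'/H'$ satisfies $\omega(0)=0$ and $$|\omega(z)|\le\sqrt{(1-\lambda^2)(1-4\lambda^2)^2}\qquad\text{for all } z\in\mathbb{D}.$$ Then $F$ is sense-preserving in $\mathbb{D}$ (its Jacobian $|H'|^2-|G'|^2$ is positive there) and close-to-convex: $F$ is harmonic and univalent in $\mathbb{D}$, and the complement $D=\mathbb{C}\setminus F(\mathbb{D})$ is a union of pairwise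 non-intersecting closed half-lines that emanate on the boundary $\partial D$ and lie completely in $D$. Moreover, $|\arg(H'(z)+\varepsilon G'(z))|\le\frac{\pi}{2}$ for all $z\in\mathbb{D}$ and all $\varepsilon\in\mathbb{C}$ with $|\varepsilon|=1$, where $\arg$ is the principal argument. -/

import Mathlib

namespace HarmonicMaps

/-- The open unit disk in the complex plane. -/
def unitDisk : Set ℂ := Metric.ball (0 : ℂ) 1

/-- Functions analytic in the unit disk with `f 0 = 0` and `f' 0 = 1`. -/
def classA : Set (ℂ → ℂ) :=
  {f | DifferentiableOn ℂ f unitDisk ∧ f 0 = 0 ∧ deriv f 0 = 1}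

/-- The class `U(lam)`: normalized analytic functions, not vanishing in the punctured disk, with
`|(z / f z) ^ 2 * f' z - 1| < lam` in the disk. At the removable singularity `z = 0` the expression
has the value `0`, so that only the points `z ≠ 0` carry a condition. -/
def classU (lam : ℝ) : Set (ℂ → ℂ) :=
  {f | f ∈ classA ∧ ∀ z ∈ unitDisk, z ≠ 0 →
    f z ≠ 0 ∧ ‖(z / f z) ^ 2 * deriv f z - 1‖ < lam}

/-- The class `U₂(lam)`: the members of `U(lam)` whose second derivative vanishes at `0`. -/
def classU2 (lam : ℝ) : Set (ℂ → ℂ) :=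
  {f | f ∈ classU lam ∧ iteratedDeriv 2 f 0 = 0}

/-- The dilatation `G' / H'` of `H + conj G`. For `H ∈ U(lam)` with `lam ≤ 1` the denominator has
no zero in the unit disk. -/
noncomputable def dilatation (H G : ℂ → ℂ) (z : ℂ) : ℂ := deriv G z / deriv H z

/-- A complex-valued function is harmonic in the disk if its real and imaginary parts are. -/
def IsHarmonic (F : ℂ → ℂ) : Prop :=
  InnerProductSpace.HarmonicOnNhd (fun z => (F z).re) unitDisk ∧
    InnerProductSpace.HarmonicOnNhd (fun z => (F z).im) unitDisk

/-- The Jacobian of `F`, as a map of the real plane, is positive in the disk. -/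
def IsSensePreserving (F : ℂ → ℂ) : Prop :=
  ∀ z ∈ unitDisk, 0 < (fderiv ℝ F z).det

/-- The closed half-line emanating from `p` in the direction `v`. -/
def halfLine (p v : ℂ) : Set ℂ := {w | ∃ t : ℝ, 0 ≤ t ∧ w = p + (t : ℂ) * v}

/-- The set `D` is filled with pairwise disjoint half-lines that emanate on the boundary of `D`
and lie in `D`. -/
def IsFilledByHalfLines (D : Set ℂ) : Prop :=
  ∃ L : Set (Set ℂ),
    (∀ l ∈ L, ∃ p ∈ frontier D, ∃ v : ℂ, v ≠ 0 ∧ l = halfLine p v) ∧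
    L.PairwiseDisjoint id ∧ ⋃₀ L = D

/-- Close-to-convex harmonic mappings: harmonic and univalent in the disk, and the complement of
the image of the disk is filled with non-intersecting half-lines. -/
def IsCloseToConvex (F : ℂ → ℂ) : Prop :=
  IsHarmonic F ∧ Set.InjOn F unitDisk ∧ IsFilledByHalfLines (F '' unitDisk)ᶜ

end HarmonicMaps

open Set Filter Topology
open scoped InnerProductSpace NNReal

namespace HarmonicMaps

/-! ### Monotone operators on the unit ball. -/

section Monotone

variable {E : Type*} [NormedAddCommGroup E] [InnerProductSpace ℝ E]

/-! Write `p = z / H` and `u = p ^ 2 * H'`. Both lie within `lam` of `1`, so their arguments are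
below `arcsin lam` and `|arg H'| < 3 arcsin lam`. The bound on the dilatation is exactly `cos (3
arcsin lam)`, whence `‖G'‖ < re H'`. This gives the Jacobian and argument claims at once, and
integration along segments makes `F` strictly monotone: `⟪F a - F b, a - b⟫ > 0`, so `F` is
injective.

The half-lines come from the maximal monotone extension `T` of `F` to the closed disk. Since the
disk is bounded, `T` is onto; by strict convexity each point off the image belongs to `T ζ` for
exactly one `ζ`, and `‖ζ‖ = 1`. Each such `T ζ` is closed, invariant under adding nonnegative
multiples of `ζ` and bounded in direction `-ζ`, so it splits into disjoint parallel half-lines.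
Solvability of `p - s • ζ ∈ T ζ` places their endpoints on the frontier. -/

/-- A strongly monotone Lipschitz operator on a complete convex set has a solution of the
variational inequality. -/
theorem exists_variational_solution [CompleteSpace E] {K : Set E} (hne : K.Nonempty)
    (hK : IsClosed K) (hconv : Convex ℝ K) {A : E → E} {s L : ℝ} (hs : 0 < s) (hsL : s ≤ L)
    (hmono : ∀ x ∈ K, ∀ y ∈ K, s * ‖x - y‖ ^ 2 ≤ ⟪A x - A y, x - y⟫_ℝ)
    (hlip : ∀ x ∈ K, ∀ y ∈ K, ‖A x - A y‖ ≤ L * ‖x - y‖) :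
    ∃ x ∈ K, ∀ y ∈ K, 0 ≤ ⟪A x, y - x⟫_ℝ := by
  have hproj : ∀ u : E, ∃ v ∈ K, ∀ w ∈ K, ⟪u - v, w - v⟫_ℝ ≤ 0 := by
    intro u
    obtain ⟨v, hv, hmin⟩ := exists_norm_eq_iInf_of_complete_convex hne hK.isComplete hconv u
    exact ⟨v, hv, (norm_eq_iInf_iff_real_inner_le_zero hconv hv).1 hmin⟩
  choose P hPK hP using hproj
  have hPne : ∀ u v : E, ‖P u - P v‖ ≤ ‖u - v‖ := by
    intro u v
    have h1 := hP u (P v) (hPK v)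
    have h2 := hP v (P u) (hPK u)
    have h3 : ‖P u - P v‖ ^ 2 ≤ ⟪u - v, P u - P v⟫_ℝ := by
      have : ⟪u - v, P u - P v⟫_ℝ - ⟪P u - P v, P u - P v⟫_ℝ =
          - ⟪u - P u, P v - P u⟫_ℝ - ⟪v - P v, P u - P v⟫_ℝ := by
        simp only [inner_sub_left, inner_sub_right]; ring
      rw [← real_inner_self_eq_norm_sq]; linarith
    have h4 := real_inner_le_norm (u - v) (P u - P v)
    by_contra! hlt
    have : 0 < ‖P u - P v‖ := lt_of_le_of_lt (norm_nonneg _) hlt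
    nlinarith
  have hL : 0 < L := hs.trans_le hsL
  -- This step size minimises `1 - 2τs + τ²L²`, the bound on the squared contraction factor; the
  -- minimum is `1 - s²/L²`.
  set τ : ℝ := s / L ^ 2 with hτ
  have hτ0 : 0 < τ := by positivity
  set k : ℝ := Real.sqrt (1 - s ^ 2 / L ^ 2) with hk
  have hk0 : 0 ≤ 1 - s ^ 2 / L ^ 2 := by
    rw [sub_nonneg, div_le_one (by positivity)]; gcongr
  have hk1 : k < 1 := by
    rw [hk, Real.sqrt_lt' one_pos]
    have : 0 < s ^ 2 / L ^ 2 := by positivity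
    linarith
  have hcontr : ∀ x ∈ K, ∀ y ∈ K, ‖(x - τ • A x) - (y - τ • A y)‖ ≤ k * ‖x - y‖ := by
    intro x hx y hy
    have h1 := hmono x hx y hy
    have h2 := hlip x hx y hy
    have e : (x - τ • A x) - (y - τ • A y) = (x - y) - τ • (A x - A y) := by
      rw [smul_sub]; abel
    apply le_of_sq_le_sq _ (by positivity)
    rw [mul_pow, hk, Real.sq_sqrt hk0, e, norm_sub_sq_real, norm_smul, inner_smul_right,
      real_inner_comm, mul_pow, Real.norm_eq_abs, sq_abs]
    have h3 : ‖A x - A y‖ ^ 2 ≤ L ^ 2 * ‖x - y‖ ^ 2 := by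
      rw [← mul_pow]; gcongr
    have h4 : τ ^ 2 * ‖A x - A y‖ ^ 2 ≤ τ * (s * ‖x - y‖ ^ 2) := by
      calc τ ^ 2 * ‖A x - A y‖ ^ 2 ≤ τ ^ 2 * (L ^ 2 * ‖x - y‖ ^ 2) := by gcongr
        _ = _ := by rw [hτ]; field_simp
    have h5 : τ * (s * ‖x - y‖ ^ 2) ≤ τ * ⟪A x - A y, x - y⟫_ℝ := by gcongr
    have h6 : s ^ 2 / L ^ 2 = τ * s := by rw [hτ]; ring
    rw [h6]
    linarith
  -- A fixed point of the projected step solves the variational inequality.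
  let Φ : K → K := fun x => ⟨P (x - τ • A x), hPK _⟩
  have hΦ : ContractingWith ⟨k, Real.sqrt_nonneg _⟩ Φ := by
    refine ⟨by exact_mod_cast hk1, LipschitzWith.of_dist_le_mul fun x y => ?_⟩
    rw [Subtype.dist_eq, Subtype.dist_eq, dist_eq_norm, dist_eq_norm]
    exact (hPne _ _).trans (hcontr x x.2 y y.2)
  have : CompleteSpace K := hK.completeSpace_coe
  have : Nonempty K := hne.to_subtype
  obtain ⟨x, hx⟩ : ∃ x : K, Φ x = x := ⟨_, hΦ.fixedPoint_isFixedPt⟩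
  have hfix : P (x - τ • A x) = x := congrArg Subtype.val hx
  refine ⟨x, x.2, fun y hy => ?_⟩
  have h := hP (x - τ • A x) y hy
  rw [hfix, sub_sub_cancel_left, inner_neg_left, inner_smul_left] at h
  simp only [conj_trivial] at h
  nlinarith

/-! ### The maximal monotone extension. -/

/-- The maximal monotone extension of `F`, given on the open unit ball. -/
def monotoneExt (F : E → E) (ζ : E) : Set E :=
  {w | ∀ y ∈ Metric.ball (0 : E) 1, 0 ≤ ⟪w - F y, ζ - y⟫_ℝ}

variable {F : E → E}

/-- Minty's trick: test against `y = ζ + t • (w - F ζ)`, divide by `t` and let `t` decrease to `0`.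
-/
theorem eq_of_mem_monotoneExt (hF : ContinuousOn F (Metric.ball 0 1)) {ζ w : E}
    (hζ : ζ ∈ Metric.ball (0 : E) 1) (hw : w ∈ monotoneExt F ζ) : w = F ζ := by
  set v := w - F ζ with hv
  have hcF : ContinuousAt F ζ := hF.continuousAt (Metric.isOpen_ball.mem_nhds hζ)
  have hlin : Tendsto (fun t : ℝ => ζ + t • v) (𝓝 0) (𝓝 ζ) := by
    have : Continuous fun t : ℝ => ζ + t • v := by fun_prop
    simpa using this.tendsto 0
  have hlim : Tendsto (fun t : ℝ => ⟪w - F (ζ + t • v), v⟫_ℝ) (𝓝[>] 0) (𝓝 ⟪w - F ζ, v⟫_ℝ) :=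
    ((tendsto_const_nhds.sub (hcF.tendsto.comp hlin)).inner tendsto_const_nhds).mono_left
      nhdsWithin_le_nhds
  have hle : ⟪w - F ζ, v⟫_ℝ ≤ 0 := by
    refine le_of_tendsto hlim ?_
    have hmem : ∀ᶠ t : ℝ in 𝓝[>] 0, ζ + t • v ∈ Metric.ball (0 : E) 1 :=
      nhdsWithin_le_nhds (hlin (Metric.isOpen_ball.mem_nhds hζ))
    filter_upwards [hmem, self_mem_nhdsWithin] with t ht ht0
    have h := hw _ ht
    rw [sub_add_cancel_left, inner_neg_right, inner_smul_right] at h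
    have ht0 : 0 < t := ht0
    by_contra! hc
    nlinarith
  rw [← hv, real_inner_self_nonpos] at hle
  exact sub_eq_zero.1 hle

theorem mem_monotoneExt_midpoint {ζ ξ w : E} (h₁ : w ∈ monotoneExt F ζ)
    (h₂ : w ∈ monotoneExt F ξ) : w ∈ monotoneExt F (midpoint ℝ ζ ξ) := by
  intro y hy
  have e : midpoint ℝ ζ ξ - y = (1 / 2 : ℝ) • ((ζ - y) + (ξ - y)) := by
    rw [midpoint_eq_smul_add, invOf_eq_inv]; module
  rw [e, inner_smul_right, inner_add_right]
  have := h₁ y hy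
  have := h₂ y hy
  positivity

theorem midpoint_mem_ball {ζ ξ : E} (hζ : ‖ζ‖ ≤ 1) (hξ : ‖ξ‖ ≤ 1) (hne : ζ ≠ ξ) :
    midpoint ℝ ζ ξ ∈ Metric.ball (0 : E) 1 := by
  rw [mem_ball_zero_iff, midpoint_eq_smul_add, norm_smul]
  have h := parallelogram_law_with_norm ℝ ζ ξ
  have hpos : 0 < ‖ζ - ξ‖ := norm_pos_iff.2 (sub_ne_zero.2 hne)
  have : ‖ζ + ξ‖ < 2 := by
    by_contra! hc
    nlinarith [norm_nonneg ζ, norm_nonneg ξ]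
  norm_num
  linarith

theorem apply_mem_monotoneExt
    (hmono : ∀ x ∈ Metric.ball (0 : E) 1, ∀ y ∈ Metric.ball (0 : E) 1,
      x ≠ y → 0 < ⟪F x - F y, x - y⟫_ℝ) {ζ : E} (hζ : ζ ∈ Metric.ball (0 : E) 1) :
    F ζ ∈ monotoneExt F ζ := by
  intro y hy
  rcases eq_or_ne ζ y with rfl | h
  · simp
  · exact (hmono ζ hζ y hy h).le

theorem injOn_of_strictMonotone
    (hmono : ∀ x ∈ Metric.ball (0 : E) 1, ∀ y ∈ Metric.ball (0 : E) 1,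
      x ≠ y → 0 < ⟪F x - F y, x - y⟫_ℝ) : InjOn F (Metric.ball 0 1) := by
  intro x hx y hy h
  by_contra hne
  simpa [h] using hmono x hx y hy hne

/-- Otherwise the midpoint would be interior, where the extension is just `F`, and `w` would be in
the image. -/
theorem eq_of_mem_monotoneExt_of_notMem (hF : ContinuousOn F (Metric.ball 0 1)) {ζ ξ w : E}
    (hζ : ‖ζ‖ ≤ 1) (hξ : ‖ξ‖ ≤ 1) (h₁ : w ∈ monotoneExt F ζ) (h₂ : w ∈ monotoneExt F ξ)
    (hw : w ∉ F '' Metric.ball 0 1) : ζ = ξ := by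
  by_contra hne
  have hm := midpoint_mem_ball hζ hξ hne
  exact hw ⟨_, hm, (eq_of_mem_monotoneExt hF hm (mem_monotoneExt_midpoint h₁ h₂)).symm⟩

theorem notMem_image_of_mem_monotoneExt (hF : ContinuousOn F (Metric.ball 0 1))
    (hmono : ∀ x ∈ Metric.ball (0 : E) 1, ∀ y ∈ Metric.ball (0 : E) 1,
      x ≠ y → 0 < ⟪F x - F y, x - y⟫_ℝ) {ζ w : E} (hζ : ‖ζ‖ = 1) (hw : w ∈ monotoneExt F ζ) :
    w ∉ F '' Metric.ball 0 1 := by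
  rintro ⟨y, hy, rfl⟩
  have hne : ζ ≠ y := by
    rintro rfl
    rw [mem_ball_zero_iff] at hy
    exact hy.ne hζ
  have hm := midpoint_mem_ball hζ.le (mem_ball_zero_iff.1 hy).le hne
  have h := eq_of_mem_monotoneExt hF hm
    (mem_monotoneExt_midpoint hw (apply_mem_monotoneExt hmono hy))
  have := injOn_of_strictMonotone hmono hy hm h
  exact hne (by simpa using this.symm)

theorem norm_eq_one_of_notMem_image (hF : ContinuousOn F (Metric.ball 0 1)) {ζ w : E}
    (hζ : ‖ζ‖ ≤ 1) (h : w ∈ monotoneExt F ζ) (hw : w ∉ F '' Metric.ball 0 1) : ‖ζ‖ = 1 := by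
  by_contra hne
  have hm : ζ ∈ Metric.ball (0 : E) 1 := mem_ball_zero_iff.2 (lt_of_le_of_ne hζ hne)
  exact hw ⟨ζ, hm, (eq_of_mem_monotoneExt hF hm h).symm⟩

/-- The vector `ζ` is an outer normal of the ball at `ζ`: `⟪ζ, ζ - y⟫ ≥ 0`. -/
theorem add_smul_mem_monotoneExt {ζ w : E} (hζ : ‖ζ‖ = 1) (hw : w ∈ monotoneExt F ζ) {t : ℝ}
    (ht : 0 ≤ t) : w + t • ζ ∈ monotoneExt F ζ := by
  intro y hy
  have h := hw y hy
  have hy' := mem_ball_zero_iff.1 hy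
  have h1 : 0 ≤ ⟪ζ, ζ - y⟫_ℝ := by
    rw [inner_sub_right, real_inner_self_eq_norm_sq, hζ]
    have := real_inner_le_norm ζ y
    rw [hζ] at this
    linarith
  rw [add_sub_right_comm, inner_add_left, real_inner_smul_left]
  positivity

theorem isClosed_monotoneExt (ζ : E) : IsClosed (monotoneExt F ζ) := by
  have : monotoneExt F ζ = ⋂ y ∈ Metric.ball (0 : E) 1, {w | 0 ≤ ⟪w - F y, ζ - y⟫_ℝ} := by
    ext w; simp [monotoneExt]
  rw [this]
  exact isClosed_biInter fun y _ => isClosed_le continuous_const (by fun_prop)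

/-- Every line in the direction of a boundary point `ζ` meets the value of the extension at `ζ`
in a set with a first point. -/
theorem exists_first_mem_monotoneExt {ζ w : E} (hζ : ‖ζ‖ = 1) (hw : w ∈ monotoneExt F ζ) :
    ∃ t : ℝ, 0 ≤ t ∧ w - t • ζ ∈ monotoneExt F ζ ∧
      ∀ s : ℝ, 0 < s → w - t • ζ - s • ζ ∉ monotoneExt F ζ := by
  set R : Set ℝ := {t | w - t • ζ ∈ monotoneExt F ζ} with hR
  have h0 : (0 : ℝ) ∈ R := by simpa [hR] using hw
  have hbdd : BddAbove R := by
    refine ⟨⟪w - F 0, ζ⟫_ℝ, fun t ht => ?_⟩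
    have h := ht 0 (by simp)
    rw [sub_zero, sub_right_comm, inner_sub_left, real_inner_smul_left,
      real_inner_self_eq_norm_sq, hζ] at h
    linarith
  have hcl : IsClosed R := (isClosed_monotoneExt ζ).preimage (by fun_prop)
  refine ⟨sSup R, le_csSup hbdd h0, hcl.csSup_mem ⟨0, h0⟩ hbdd, fun s hs hmem => ?_⟩
  have : sSup R + s ∈ R := by
    rw [sub_sub, ← add_smul] at hmem
    exact hmem
  linarith [le_csSup hbdd this]

/-- The resolvents of the inverse of the maximal monotone extension are everywhere defined. -/
theorem exists_sub_smul_mem_monotoneExt_of_pos [FiniteDimensional ℝ E]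
    (hlip : ∀ r < 1, ∃ L : ℝ≥0, LipschitzOnWith L F (Metric.closedBall 0 r))
    (hmono : ∀ x ∈ Metric.ball (0 : E) 1, ∀ y ∈ Metric.ball (0 : E) 1,
      x ≠ y → 0 < ⟪F x - F y, x - y⟫_ℝ) (p : E) {s : ℝ} (hs : 0 < s) :
    ∃ ζ : E, ‖ζ‖ ≤ 1 ∧ p - s • ζ ∈ monotoneExt F ζ := by
  have : CompleteSpace E := FiniteDimensional.complete ℝ E
  have hmono' : ∀ x ∈ Metric.ball (0 : E) 1, ∀ y ∈ Metric.ball (0 : E) 1,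
      0 ≤ ⟪F x - F y, x - y⟫_ℝ := fun x hx y hy => by
    have := apply_mem_monotoneExt hmono hx y hy
    exact this
  have hstep : ∀ n : ℕ, ∃ ζ : E, ‖ζ‖ ≤ 1 ∧ ∀ y : E, ‖y‖ ≤ 1 - 1 / ((n : ℝ) + 1) →
      0 ≤ ⟪p - s • ζ - F y, ζ - y⟫_ℝ := by
    intro n
    -- `F` is Lipschitz only on smaller balls, so the inequality is solved there and the radius then
    -- tends to `1`.
    set r : ℝ := 1 - 1 / ((n : ℝ) + 1) with hr
    have hn : 0 < 1 / ((n : ℝ) + 1) := by positivity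
    have hn1 : 1 / ((n : ℝ) + 1) ≤ 1 := by
      rw [div_le_one (by positivity)]; linarith [n.cast_nonneg (α := ℝ)]
    have hr0 : 0 ≤ r := by linarith
    have hr1 : r < 1 := by linarith
    have hsub : Metric.closedBall (0 : E) r ⊆ Metric.ball 0 1 :=
      Metric.closedBall_subset_ball hr1
    obtain ⟨L, hL⟩ := hlip r hr1
    obtain ⟨ζ, hζ, hsol⟩ := exists_variational_solution (K := Metric.closedBall (0 : E) r)
      ⟨0, by simpa using hr0⟩ Metric.isClosed_closedBall (convex_closedBall _ _)
      (A := fun x => F x + s • x - p) (s := s) (L := L + s) hs (by simp)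
      (fun x hx y hy => by
        have h := hmono' x (hsub hx) y (hsub hy)
        have e : F x + s • x - p - (F y + s • y - p) = (F x - F y) + s • (x - y) := by
          module
        rw [e, inner_add_left, real_inner_smul_left, real_inner_self_eq_norm_sq]
        linarith)
      (fun x hx y hy => by
        have h := hL.dist_le_mul x hx y hy
        rw [dist_eq_norm, dist_eq_norm] at h
        have e : F x + s • x - p - (F y + s • y - p) = (F x - F y) + s • (x - y) := by
          module
        rw [e]
        refine (norm_add_le _ _).trans ?_
        rw [norm_smul, Real.norm_of_nonneg hs.le, add_mul]
        gcongr)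
    refine ⟨ζ, (mem_closedBall_zero_iff.1 hζ).trans hr1.le, fun y hy => ?_⟩
    have hy' : y ∈ Metric.closedBall (0 : E) r := mem_closedBall_zero_iff.2 hy
    have h1 := hsol y hy'
    have h2 := hmono' ζ (hsub hζ) y (hsub hy')
    -- Monotonicity trades `F ζ` for `F y`, so the limit needs no control of `F` at the boundary.
    have e : ⟪p - s • ζ - F y, ζ - y⟫_ℝ =
        ⟪F ζ + s • ζ - p, y - ζ⟫_ℝ + ⟪F ζ - F y, ζ - y⟫_ℝ := by
      rw [← neg_sub ζ y, inner_neg_right, ← inner_neg_left, ← inner_add_left]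
      congr 1
      module
    rw [e]
    positivity
  choose ζ hζ hsol using hstep
  obtain ⟨ξ, hξ, φ, hφ, hlim⟩ := (isCompact_closedBall (0 : E) 1).tendsto_subseq
    (x := ζ) fun n => mem_closedBall_zero_iff.2 (hζ n)
  refine ⟨ξ, mem_closedBall_zero_iff.1 hξ, fun y hy => ?_⟩
  have hlim' : Tendsto (fun n => ⟪p - s • ζ (φ n) - F y, ζ (φ n) - y⟫_ℝ) atTop
      (𝓝 ⟪p - s • ξ - F y, ξ - y⟫_ℝ) := by
    have hc : Continuous fun x : E => ⟪p - s • x - F y, x - y⟫_ℝ := by fun_prop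
    exact (hc.tendsto ξ).comp hlim
  refine ge_of_tendsto hlim' ?_
  have hev : Tendsto (fun n : ℕ => 1 - 1 / ((n : ℝ) + 1)) atTop (𝓝 1) := by
    simpa using (tendsto_one_div_add_atTop_nhds_zero_nat (𝕜 := ℝ)).const_sub 1
  filter_upwards [(hev.comp hφ.tendsto_atTop).eventually_const_le (mem_ball_zero_iff.1 hy)]
    with n hn
  exact hsol _ y hn

/-- The maximal monotone extension of an operator on the unit ball is onto. -/
theorem exists_mem_monotoneExt [FiniteDimensional ℝ E]
    (hlip : ∀ r < 1, ∃ L : ℝ≥0, LipschitzOnWith L F (Metric.closedBall 0 r))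
    (hmono : ∀ x ∈ Metric.ball (0 : E) 1, ∀ y ∈ Metric.ball (0 : E) 1,
      x ≠ y → 0 < ⟪F x - F y, x - y⟫_ℝ) (p : E) :
    ∃ ζ : E, ‖ζ‖ ≤ 1 ∧ p ∈ monotoneExt F ζ := by
  -- The points `ζ n` stay bounded, so the perturbation `s • ζ n` vanishes as `s` tends to `0`.
  choose ζ hζ hsol using fun n : ℕ => exists_sub_smul_mem_monotoneExt_of_pos hlip hmono p
    (s := 1 / ((n : ℝ) + 1)) (by positivity)
  obtain ⟨ξ, hξ, φ, hφ, hlim⟩ := (isCompact_closedBall (0 : E) 1).tendsto_subseq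
    (x := ζ) fun n => mem_closedBall_zero_iff.2 (hζ n)
  refine ⟨ξ, mem_closedBall_zero_iff.1 hξ, fun y hy => ?_⟩
  have hs : Tendsto (fun n => 1 / ((φ n : ℝ) + 1)) atTop (𝓝 0) :=
    (tendsto_one_div_add_atTop_nhds_zero_nat (𝕜 := ℝ)).comp hφ.tendsto_atTop
  have hlim' : Tendsto (fun n => ⟪p - (1 / ((φ n : ℝ) + 1)) • ζ (φ n) - F y, ζ (φ n) - y⟫_ℝ)
      atTop (𝓝 ⟪p - (0 : ℝ) • ξ - F y, ξ - y⟫_ℝ) :=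
    (((tendsto_const_nhds.sub (hs.smul hlim)).sub tendsto_const_nhds).inner
      (hlim.sub tendsto_const_nhds))
  rw [zero_smul, sub_zero] at hlim'
  exact ge_of_tendsto' hlim' fun n => hsol (φ n) y hy

end Monotone

/-! ### Half-lines filling the complement. -/

/-- The complement of the image of the disk under a strictly monotone map is filled with
half-lines. -/
theorem isFilledByHalfLines_compl_image {F : ℂ → ℂ} (hF : ContinuousOn F unitDisk)
    (hlip : ∀ r < 1, ∃ L : ℝ≥0, LipschitzOnWith L F (Metric.closedBall 0 r))
    (hmono : ∀ x ∈ unitDisk, ∀ y ∈ unitDisk, x ≠ y → 0 < ⟪F x - F y, x - y⟫_ℝ) :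
    IsFilledByHalfLines (F '' unitDisk)ᶜ := by
  unfold unitDisk at *
  have hmem : ∀ {ζ p w : ℂ}, ‖ζ‖ = 1 → p ∈ monotoneExt F ζ → w ∈ halfLine p ζ →
      w ∈ monotoneExt F ζ := by
    rintro ζ p w hζ hp ⟨t, ht, rfl⟩
    simpa using add_smul_mem_monotoneExt hζ hp ht
  refine ⟨{l | ∃ ζ p : ℂ, ‖ζ‖ = 1 ∧ p ∈ monotoneExt F ζ ∧
    (∀ s : ℝ, 0 < s → p - s • ζ ∉ monotoneExt F ζ) ∧ l = halfLine p ζ}, ?_, ?_, ?_⟩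
  · rintro l ⟨ζ, p, hζ, hp, hfirst, rfl⟩
    refine ⟨p, ?_, ζ, norm_ne_zero_iff.1 (by simp [hζ]), rfl⟩
    have hpD := notMem_image_of_mem_monotoneExt hF hmono hζ hp
    -- If `p` were interior to the complement, a small resolvent step would stay there; uniqueness
    -- forces its direction to be `ζ`, giving a point of the fibre before the first one.
    refine ⟨subset_closure hpD, fun hint => ?_⟩
    obtain ⟨ε, hε, hball⟩ := Metric.mem_nhds_iff.1 (mem_interior_iff_mem_nhds.1 hint)
    obtain ⟨ξ, hξ, hmemξ⟩ := exists_sub_smul_mem_monotoneExt_of_pos hlip hmono p (half_pos hε)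
    have hnear : p - (ε / 2) • ξ ∈ Metric.ball p ε := by
      rw [mem_ball_iff_norm, sub_sub_cancel_left, norm_neg, norm_smul,
        Real.norm_of_nonneg (half_pos hε).le]
      nlinarith
    have hξ1 := norm_eq_one_of_notMem_image hF hξ hmemξ (hball hnear)
    have hpξ : p ∈ monotoneExt F ξ := by
      simpa using add_smul_mem_monotoneExt hξ1 hmemξ (half_pos hε).le
    obtain rfl := eq_of_mem_monotoneExt_of_notMem hF hζ.le hξ hp hpξ hpD
    exact hfirst _ (half_pos hε) hmemξ
  · rintro _ ⟨ζ, p, hζ, hp, hpf, rfl⟩ _ ⟨ξ, q, hξ, hq, hqf, rfl⟩ hne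
    rw [Function.onFun, id, id, Set.disjoint_left]
    intro w hw hw'
    apply hne
    have h1 := hmem hζ hp hw
    have h2 := hmem hξ hq hw'
    obtain rfl := eq_of_mem_monotoneExt_of_notMem hF hζ.le hξ.le h1 h2
      (notMem_image_of_mem_monotoneExt hF hmono hζ h1)
    obtain ⟨t, ht, rfl⟩ := hw
    obtain ⟨u, hu, he⟩ := hw'
    have hle : ¬ 0 < t - u := fun h => hqf _ h (by
      have : q - (t - u) • ζ = p := by
        rw [Complex.real_smul]; push_cast; linear_combination -he
      rwa [this])
    have hge : ¬ 0 < u - t := fun h => hpf _ h (by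
      have : p - (u - t) • ζ = q := by
        rw [Complex.real_smul]; push_cast; linear_combination he
      rwa [this])
    obtain rfl : t = u := by linarith
    rw [add_right_cancel he]
  · ext w
    constructor
    · rintro ⟨_, ⟨ζ, p, hζ, hp, -, rfl⟩, hw⟩
      exact notMem_image_of_mem_monotoneExt hF hmono hζ (hmem hζ hp hw)
    · intro hw
      obtain ⟨ζ, hζ, hwζ⟩ := exists_mem_monotoneExt hlip hmono w
      have hζ1 := norm_eq_one_of_notMem_image hF hζ hwζ hw
      obtain ⟨t, ht, hmemt, hfirst⟩ := exists_first_mem_monotoneExt hζ1 hwζ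
      exact ⟨_, ⟨ζ, _, hζ1, hmemt, hfirst, rfl⟩, t, ht, by simp⟩

/-! ### Estimates for the class `U₂(lam)`. -/

theorem isOpen_unitDisk : IsOpen unitDisk := Metric.isOpen_ball

theorem zero_mem_unitDisk : (0 : ℂ) ∈ unitDisk := Metric.mem_ball_self one_pos

/-- An analytic function on the disk satisfying `‖z ^ 2 * f z‖ ≤ C` is bounded by `C`. -/
theorem norm_le_of_norm_sq_mul_le {f : ℂ → ℂ} {C : ℝ} (hf : DifferentiableOn ℂ f unitDisk)
    (h : ∀ z ∈ unitDisk, ‖z ^ 2 * f z‖ ≤ C) {z : ℂ} (hz : z ∈ unitDisk) : ‖f z‖ ≤ C := by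
  have hz1 : ‖z‖ < 1 := mem_ball_zero_iff.1 hz
  have key : ∀ r : ℝ, ‖z‖ < r → r < 1 → ‖f z‖ ≤ C / r ^ 2 := by
    intro r hzr hr1
    have hr0 : 0 < r := (norm_nonneg z).trans_lt hzr
    have hsub : Metric.closedBall (0 : ℂ) r ⊆ unitDisk := Metric.closedBall_subset_ball hr1
    refine Complex.norm_le_of_forall_mem_frontier_norm_le (U := Metric.ball (0 : ℂ) r)
      Metric.isBounded_ball ((hf.mono hsub).diffContOnCl_ball subset_rfl) (fun w hw => ?_)
      (subset_closure (mem_ball_zero_iff.2 hzr))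
    rw [frontier_ball _ hr0.ne', mem_sphere_zero_iff_norm] at hw
    have := h w (hsub (mem_closedBall_zero_iff.2 hw.le))
    rw [norm_mul, norm_pow, hw] at this
    rw [le_div_iff₀ (by positivity)]
    linarith
  have hlim : Tendsto (fun r : ℝ => C / r ^ 2) (𝓝[<] 1) (𝓝 C) := by
    have : ContinuousAt (fun r : ℝ => C / r ^ 2) 1 := by
      apply ContinuousAt.div <;> first | fun_prop | norm_num
    simpa using this.tendsto.mono_left nhdsWithin_le_nhds
  refine ge_of_tendsto hlim ?_
  filter_upwards [Ioo_mem_nhdsLT hz1] with r hr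
  exact key r hr.1 hr.2

/-- For `H ∈ U₂(lam)`, both `z / H z` and `(z / H z) ^ 2 * H' z` lie in the disk of center `1` and
radius `lam`. -/
theorem exists_sq_mul_deriv_eq {lam : ℝ} (hlam0 : 0 < lam) {H : ℂ → ℂ} (hH : H ∈ classU2 lam)
    {z : ℂ} (hz : z ∈ unitDisk) :
    ∃ p u : ℂ, ‖p - 1‖ < lam ∧ ‖u - 1‖ < lam ∧ p ^ 2 * deriv H z = u := by
  obtain ⟨⟨⟨hd, hH0, hH1⟩, hU⟩, hH2⟩ := hH
  set k : ℂ → ℂ := dslope H 0 with hk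
  have hk0 : k 0 = 1 := by rw [hk, dslope_same, hH1]
  have hHk : ∀ w, H w = w * k w := fun w => by
    have := sub_smul_dslope H 0 w
    rw [sub_zero, hH0, sub_zero, smul_eq_mul] at this
    exact this.symm
  have hkd : DifferentiableOn ℂ k unitDisk :=
    (Complex.differentiableOn_dslope (isOpen_unitDisk.mem_nhds zero_mem_unitDisk)).2 hd
  have hkne : ∀ w ∈ unitDisk, k w ≠ 0 := by
    intro w hw h
    rcases eq_or_ne w 0 with rfl | hw0
    · simp [hk0] at h
    · exact (hU w hw hw0).1 (by rw [hHk, h, mul_zero])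
  have hk' : ∀ w ∈ unitDisk, HasDerivAt k (deriv k w) w := fun w hw =>
    (hkd.differentiableAt (isOpen_unitDisk.mem_nhds hw)).hasDerivAt
  have hH' : ∀ w ∈ unitDisk, deriv H w = k w + w * deriv k w := by
    intro w hw
    have h := (hasDerivAt_id w).mul (hk' w hw)
    have e : H = id * k := funext hHk
    rw [e, h.deriv]
    simp
  have hk'd : DifferentiableOn ℂ (deriv k) unitDisk := hkd.deriv isOpen_unitDisk
  have hk'0 : deriv k 0 = 0 := by
    have h2 : HasDerivAt (deriv k) (deriv (deriv k) 0) 0 :=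
      (hk'd.differentiableAt (isOpen_unitDisk.mem_nhds zero_mem_unitDisk)).hasDerivAt
    have h := (hk' 0 zero_mem_unitDisk).add ((hasDerivAt_id 0).mul h2)
    have e : deriv H =ᶠ[𝓝 0] k + id * deriv k := by
      filter_upwards [isOpen_unitDisk.mem_nhds zero_mem_unitDisk] with w hw
      exact hH' w hw
    rw [iteratedDeriv_succ, iteratedDeriv_one, e.deriv_eq, h.deriv] at hH2
    simp only [id, one_mul, zero_mul, add_zero] at hH2
    exact add_self_eq_zero.1 hH2
  set p : ℂ → ℂ := fun w => (k w)⁻¹ with hp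
  have hpd : DifferentiableOn ℂ p unitDisk := hkd.inv hkne
  have hp' : ∀ w ∈ unitDisk, HasDerivAt p (-deriv k w / k w ^ 2) w := fun w hw =>
    (hk' w hw).inv (hkne w hw)
  set q : ℂ → ℂ := dslope p 0 with hq
  have hqd : DifferentiableOn ℂ q unitDisk :=
    (Complex.differentiableOn_dslope (isOpen_unitDisk.mem_nhds zero_mem_unitDisk)).2 hpd
  have hq0 : q 0 = 0 := by
    rw [hq, dslope_same, (hp' 0 zero_mem_unitDisk).deriv, hk'0, neg_zero, zero_div]
  have hpq : ∀ w, p w = 1 + w * q w := fun w => by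
    have := sub_smul_dslope p 0 w
    have hp0 : p 0 = 1 := by simp [hp, hk0]
    rw [sub_zero, hp0, smul_eq_mul] at this
    linear_combination -this
  have hpq' : ∀ w ∈ unitDisk, -deriv k w / k w ^ 2 = q w + w * deriv q w := by
    intro w hw
    have hqw := (hqd.differentiableAt (isOpen_unitDisk.mem_nhds hw)).hasDerivAt
    have h : HasDerivAt (fun w => 1 + w * q w) (1 * q w + w * deriv q w) w :=
      ((hasDerivAt_id' w).mul hqw).const_add 1
    rw [← funext hpq] at h
    rw [(hp' w hw).unique h, one_mul]
  -- With `p = 1 + w q`, the defining bound becomes `‖w² q'‖ < lam`, hence `‖q'‖ ≤ lam`. As `H''(0)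
  -- = 0` gives `q 0 = 0`, integration yields `‖q‖ ≤ lam ‖w‖`.
  have hu : ∀ w ∈ unitDisk, p w ^ 2 * deriv H w - 1 = -(w ^ 2 * deriv q w) := by
    intro w hw
    have h1 : p w ^ 2 * deriv H w = p w - w * (-deriv k w / k w ^ 2) := by
      have := hkne w hw
      rw [hH' w hw, hp]
      field_simp
      ring
    rw [h1, hpq' w hw, hpq w]
    ring
  have hUp : ∀ w ∈ unitDisk, ‖p w ^ 2 * deriv H w - 1‖ < lam := by
    intro w hw
    rcases eq_or_ne w 0 with rfl | hw0
    · simpa [hp, hk0, hH1] using hlam0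
    · have h := (hU w hw hw0).2
      have e : w / H w = p w := by
        have := hkne w hw
        rw [hHk, hp]
        field_simp
      rwa [e] at h
  have hq'le : ∀ w ∈ unitDisk, ‖deriv q w‖ ≤ lam := fun w hw =>
    norm_le_of_norm_sq_mul_le (hqd.deriv isOpen_unitDisk) (fun v hv => by
      rw [← norm_neg, ← hu v hv]
      exact (hUp v hv).le) hw
  have hqle : ‖q z‖ ≤ lam * ‖z‖ := by
    have := (convex_ball (0 : ℂ) 1).norm_image_sub_le_of_norm_deriv_le
      (fun w hw => hqd.differentiableAt (isOpen_unitDisk.mem_nhds hw)) hq'le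
      zero_mem_unitDisk hz
    simpa [hq0] using this
  refine ⟨p z, p z ^ 2 * deriv H z, ?_, hUp z hz, rfl⟩
  have hz1 : ‖z‖ < 1 := mem_ball_zero_iff.1 hz
  rw [hpq, add_sub_cancel_left, norm_mul]
  calc ‖z‖ * ‖q z‖ ≤ 1 * (lam * ‖z‖) := by gcongr
    _ < lam := by rw [one_mul]; exact mul_lt_of_lt_one_right hlam0 hz1

/-- The tangents from the origin to the circle of center `1` and radius `lam` make the angle `arcsin
lam` with the real axis. -/
theorem abs_arg_lt_arcsin {lam : ℝ} (hlam0 : 0 < lam) (hlam : lam < 1) {u : ℂ}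
    (hu : ‖u - 1‖ < lam) : |Complex.arg u| < Real.arcsin lam := by
  have h1 : ‖u - 1‖ ^ 2 < lam ^ 2 := by gcongr
  rw [Complex.sq_norm, Complex.normSq_apply] at h1
  simp only [Complex.sub_re, Complex.sub_im, Complex.one_re, Complex.one_im, sub_zero] at h1
  have hre : 0 < u.re := by nlinarith [mul_self_nonneg u.im, mul_self_nonneg u.re]
  have hnorm : 0 < ‖u‖ := norm_pos_iff.2 (by rintro rfl; simp at hre)
  have hn : ‖u‖ ^ 2 = u.re * u.re + u.im * u.im := by
    rw [Complex.sq_norm, Complex.normSq_apply]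
  have him : |u.im / ‖u‖| < lam := by
    rw [abs_div, abs_of_pos hnorm, div_lt_iff₀ hnorm]
    refine lt_of_pow_lt_pow_left₀ 2 (by positivity) ?_
    rw [sq_abs, mul_pow, hn]
    -- The first square is the AM-GM inequality for `‖u‖²` and `1 - lam²`, applied to `2 re u > ‖u‖²
    -- + 1 - lam²`.
    nlinarith [sq_nonneg (u.re ^ 2 + u.im ^ 2 - (1 - lam ^ 2)),
      sq_nonneg (u.re * u.re + u.im * u.im - u.re), mul_pos hre hre]
  rw [abs_lt] at him
  rw [Complex.arg_of_re_nonneg hre.le, abs_lt, ← Real.arcsin_neg]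
  exact ⟨Real.arcsin_lt_arcsin (by linarith) him.1 (by linarith),
    Real.arcsin_lt_arcsin (by linarith) him.2 hlam.le⟩

theorem cos_three_mul_arcsin {x : ℝ} (hx : -1 ≤ x) (hx' : x ≤ 1) :
    Real.cos (3 * Real.arcsin x) = Real.sqrt (1 - x ^ 2) * (1 - 4 * x ^ 2) := by
  have h : Real.sqrt (1 - x ^ 2) ^ 2 = 1 - x ^ 2 := Real.sq_sqrt (by nlinarith)
  rw [Real.cos_three_mul, Real.cos_arcsin]
  linear_combination 4 * Real.sqrt (1 - x ^ 2) * h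

/-- The argument of `u / p ^ 2` is less than `3 arcsin lam`. -/
theorem sqrt_mul_norm_lt_re {lam : ℝ} (hlam0 : 0 < lam) (hlam : lam ≤ 1 / 2) {p u h : ℂ}
    (hp : ‖p - 1‖ < lam) (hu : ‖u - 1‖ < lam) (e : p ^ 2 * h = u) :
    Real.sqrt ((1 - lam ^ 2) * (1 - 4 * lam ^ 2) ^ 2) * ‖h‖ < h.re := by
  have hne : ∀ v : ℂ, ‖v - 1‖ < lam → v ≠ 0 := by
    rintro v hv rfl
    simp at hv
    linarith
  have hp0 := hne p hp
  have hu0 := hne u hu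
  have hh0 : h ≠ 0 := by rintro rfl; exact hu0 (by rw [← e, mul_zero])
  have hh : 0 < ‖h‖ := norm_pos_iff.2 hh0
  have hα := abs_arg_lt_arcsin hlam0 (by linarith) hu
  have hβ := abs_arg_lt_arcsin hlam0 (by linarith) hp
  set α := u.arg
  set β := p.arg
  have hpolar : h = (‖h‖ : ℂ) * Complex.exp ((α - 2 * β : ℝ) * Complex.I) := by
    have eu := Complex.norm_mul_exp_arg_mul_I u
    have ep := Complex.norm_mul_exp_arg_mul_I p
    have hn : ‖p‖ ^ 2 * ‖h‖ = ‖u‖ := by rw [← e, norm_mul, norm_pow]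
    have hn' : (‖p‖ : ℂ) ^ 2 * ‖h‖ = ‖u‖ := by exact_mod_cast hn
    apply mul_left_cancel₀ (pow_ne_zero 2 hp0)
    have hexp : Complex.exp (β * Complex.I) ^ 2 *
        Complex.exp ((α - 2 * β : ℝ) * Complex.I) = Complex.exp (α * Complex.I) := by
      rw [← Complex.exp_nat_mul, ← Complex.exp_add]
      congr 1
      push_cast
      ring
    calc p ^ 2 * h = ‖u‖ * Complex.exp (α * Complex.I) := by rw [e, eu]
      _ = (‖p‖ * Complex.exp (β * Complex.I)) ^ 2 *
          (‖h‖ * Complex.exp ((α - 2 * β : ℝ) * Complex.I)) := by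
        rw [← hexp, ← hn']; ring
      _ = _ := by rw [ep]
  have hre : h.re = ‖h‖ * Real.cos (α - 2 * β) := by
    conv_lhs => rw [hpolar]
    rw [Complex.re_ofReal_mul, Complex.exp_ofReal_mul_I_re]
  have h6 : 3 * Real.arcsin lam ≤ Real.pi / 2 := by
    have : Real.arcsin lam ≤ Real.pi / 6 := by
      rw [Real.arcsin_le_iff_le_sin' ⟨by linarith [Real.pi_pos], by linarith [Real.pi_pos]⟩,
        Real.sin_pi_div_six]
      exact hlam
    linarith
  have hcos : Real.cos (3 * Real.arcsin lam) < Real.cos (α - 2 * β) := by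
    rw [← Real.cos_abs (α - 2 * β)]
    apply Real.cos_lt_cos_of_nonneg_of_le_pi (abs_nonneg _) (by linarith [Real.pi_pos])
    rw [abs_lt] at *
    constructor <;> linarith
  have hsq : 0 ≤ 1 - 4 * lam ^ 2 := by nlinarith
  rw [Real.sqrt_mul (by nlinarith), Real.sqrt_sq hsq,
    ← cos_three_mul_arcsin (by linarith) (by linarith), hre, mul_comm]
  gcongr

/-! ### Harmonic maps `H + conj G`. -/

section Shear

variable {H G F : ℂ → ℂ}

theorem hasFDerivAt_add_conj (hH : DifferentiableOn ℂ H unitDisk)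
    (hG : DifferentiableOn ℂ G unitDisk)
    (hF : ∀ z ∈ unitDisk, F z = H z + (starRingEnd ℂ) (G z)) {z : ℂ} (hz : z ∈ unitDisk) :
    HasFDerivAt F (deriv H z • (1 : ℂ →L[ℝ] ℂ) +
      (Complex.conjCLE : ℂ →L[ℝ] ℂ).comp (deriv G z • (1 : ℂ →L[ℝ] ℂ))) z := by
  have hn := isOpen_unitDisk.mem_nhds hz
  have h1 := (hH.differentiableAt hn).hasDerivAt.complexToReal_fderiv
  have h2 := (hG.differentiableAt hn).hasDerivAt.complexToReal_fderiv
  refine (h1.add ((Complex.conjCLE : ℂ →L[ℝ] ℂ).hasFDerivAt.comp z h2)).congr_of_eventuallyEq ?_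
  filter_upwards [hn] with w hw
  simp [hF w hw]

theorem isSensePreserving_of_norm_deriv_lt (hH : DifferentiableOn ℂ H unitDisk)
    (hG : DifferentiableOn ℂ G unitDisk)
    (hF : ∀ z ∈ unitDisk, F z = H z + (starRingEnd ℂ) (G z))
    (hlt : ∀ z ∈ unitDisk, ‖deriv G z‖ < ‖deriv H z‖) : IsSensePreserving F := by
  intro z hz
  rw [(hasFDerivAt_add_conj hH hG hF hz).fderiv, ContinuousLinearMap.det,
    ← LinearMap.det_toMatrix Complex.basisOneI, Matrix.det_fin_two]
  have h : ‖deriv G z‖ ^ 2 < ‖deriv H z‖ ^ 2 := by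
    have := hlt z hz
    gcongr
  simp only [Complex.sq_norm, Complex.normSq_apply] at h
  simp [LinearMap.toMatrix_apply]
  nlinarith

theorem isHarmonic_add_conj (hH : DifferentiableOn ℂ H unitDisk)
    (hG : DifferentiableOn ℂ G unitDisk)
    (hF : ∀ z ∈ unitDisk, F z = H z + (starRingEnd ℂ) (G z)) : IsHarmonic F := by
  have hana : ∀ {f : ℂ → ℂ}, DifferentiableOn ℂ f unitDisk → ∀ z ∈ unitDisk,
      AnalyticAt ℂ f z := fun hf z hz => hf.analyticAt (isOpen_unitDisk.mem_nhds hz)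
  refine ⟨fun z hz => ?_, fun z hz => ?_⟩
  · refine (InnerProductSpace.harmonicAt_congr_nhds ?_).2
      ((hana hH z hz).add (hana hG z hz)).harmonicAt_re
    filter_upwards [isOpen_unitDisk.mem_nhds hz] with w hw
    simp [hF w hw]
  · refine (InnerProductSpace.harmonicAt_congr_nhds ?_).2
      ((hana hH z hz).sub (hana hG z hz)).harmonicAt_im
    filter_upwards [isOpen_unitDisk.mem_nhds hz] with w hw
    simp [hF w hw, sub_eq_add_neg]

/-- The Noshiro-Warschawski argument for `H + conj G`. -/
theorem inner_sub_pos_of_norm_deriv_lt_re (hH : DifferentiableOn ℂ H unitDisk)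
    (hG : DifferentiableOn ℂ G unitDisk)
    (hF : ∀ z ∈ unitDisk, F z = H z + (starRingEnd ℂ) (G z))
    (hlt : ∀ z ∈ unitDisk, ‖deriv G z‖ < (deriv H z).re) {a b : ℂ} (ha : a ∈ unitDisk)
    (hb : b ∈ unitDisk) (hab : a ≠ b) : 0 < ⟪F a - F b, a - b⟫_ℝ := by
  set v := a - b with hv
  have hv0 : 0 < ‖v‖ := norm_pos_iff.2 (sub_ne_zero.2 hab)
  have hmem : ∀ t ∈ Icc (0 : ℝ) 1, b + t • v ∈ unitDisk := fun t ht =>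
    (convex_ball (0 : ℂ) 1).add_smul_sub_mem hb ha ht
  set D : ℂ → ℂ →L[ℝ] ℂ := fun z => deriv H z • (1 : ℂ →L[ℝ] ℂ) +
      (Complex.conjCLE : ℂ →L[ℝ] ℂ).comp (deriv G z • (1 : ℂ →L[ℝ] ℂ)) with hD
  have hderiv : ∀ t ∈ Icc (0 : ℝ) 1, HasDerivAt (fun t : ℝ => ⟪F (b + t • v), v⟫_ℝ)
      ⟪D (b + t • v) v, v⟫_ℝ t := by
    intro t ht
    have hline : HasDerivAt (fun t : ℝ => b + t • v) v t := by
      simpa using ((hasDerivAt_id t).smul_const v).const_add b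
    have h := (hasFDerivAt_add_conj hH hG hF (hmem t ht)).comp_hasDerivAt t hline
    have h' := h.inner ℝ (hasDerivAt_const t v)
    rw [inner_zero_right, zero_add] at h'
    exact h'
  have hpos : ∀ z ∈ unitDisk, 0 < ⟪D z v, v⟫_ℝ := by
    intro z hz
    have e : ⟪D z v, v⟫_ℝ = ‖v‖ ^ 2 * (deriv H z).re + (v ^ 2 * deriv G z).re := by
      rw [Complex.inner, Complex.sq_norm, Complex.normSq_apply]
      simp [hD, pow_two]
      ring
    have h1 : -(‖v‖ ^ 2 * ‖deriv G z‖) ≤ (v ^ 2 * deriv G z).re := by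
      have := Complex.abs_re_le_norm (v ^ 2 * deriv G z)
      rw [norm_mul, norm_pow] at this
      exact (abs_le.1 this).1
    have h2 : ‖v‖ ^ 2 * ‖deriv G z‖ < ‖v‖ ^ 2 * (deriv H z).re := by
      have := hlt z hz
      gcongr
    rw [e]
    linarith
  have hmono := strictMonoOn_of_deriv_pos (convex_Icc (0 : ℝ) 1)
    (fun t ht => (hderiv t ht).continuousAt.continuousWithinAt) (fun t ht => by
      have ht' := interior_subset ht
      rw [(hderiv t ht').deriv]
      exact hpos _ (hmem t ht'))
  have h := hmono (left_mem_Icc.2 zero_le_one) (right_mem_Icc.2 zero_le_one) one_pos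
  rw [inner_sub_left]
  simp only [zero_smul, one_smul, add_zero, hv, add_sub_cancel] at h
  rw [hv]
  linarith

theorem exists_lipschitzOnWith_closedBall {f : ℂ → ℂ} (hf : DifferentiableOn ℂ f unitDisk)
    {r : ℝ} (hr : r < 1) : ∃ L : ℝ≥0, LipschitzOnWith L f (Metric.closedBall 0 r) := by
  have hsub : Metric.closedBall (0 : ℂ) r ⊆ unitDisk := Metric.closedBall_subset_ball hr
  obtain ⟨C, hC⟩ := (isCompact_closedBall (0 : ℂ) r).exists_bound_of_continuousOn
    ((hf.deriv isOpen_unitDisk).continuousOn.mono hsub)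
  refine ⟨C.toNNReal, Convex.lipschitzOnWith_of_nnnorm_deriv_le
    (fun z hz => hf.differentiableAt (isOpen_unitDisk.mem_nhds (hsub hz))) (fun z hz => ?_)
    (convex_closedBall _ _)⟩
  exact NNReal.coe_le_coe.1 ((hC z hz).trans (Real.le_coe_toNNReal C))

/-- If `‖G'‖ < re H'` in the disk, then `H + conj G` is close-to-convex. -/
theorem isCloseToConvex_of_norm_deriv_lt_re (hH : DifferentiableOn ℂ H unitDisk)
    (hG : DifferentiableOn ℂ G unitDisk)
    (hF : ∀ z ∈ unitDisk, F z = H z + (starRingEnd ℂ) (G z))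
    (hlt : ∀ z ∈ unitDisk, ‖deriv G z‖ < (deriv H z).re) : IsCloseToConvex F := by
  have hmono : ∀ x ∈ unitDisk, ∀ y ∈ unitDisk, x ≠ y → 0 < ⟪F x - F y, x - y⟫_ℝ :=
    fun x hx y hy => inner_sub_pos_of_norm_deriv_lt_re hH hG hF hlt hx hy
  refine ⟨isHarmonic_add_conj hH hG hF, injOn_of_strictMonotone hmono,
    isFilledByHalfLines_compl_image (fun z hz =>
      (hasFDerivAt_add_conj hH hG hF hz).continuousAt.continuousWithinAt) (fun r hr => ?_) hmono⟩
  obtain ⟨L, hL⟩ := exists_lipschitzOnWith_closedBall hH hr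
  obtain ⟨M, hM⟩ := exists_lipschitzOnWith_closedBall hG hr
  refine ⟨L + M, LipschitzOnWith.of_dist_le_mul fun x hx y hy => ?_⟩
  have hsub : Metric.closedBall (0 : ℂ) r ⊆ unitDisk := Metric.closedBall_subset_ball hr
  rw [hF x (hsub hx), hF y (hsub hy), NNReal.coe_add, add_mul]
  refine (dist_add_add_le _ _ _ _).trans (add_le_add (hL.dist_le_mul x hx y hy) ?_)
  rw [Complex.dist_conj_conj]
  exact hM.dist_le_mul x hx y hy

end Shear

end HarmonicMaps

theorem theorem6 (lam : ℝ) (hlam0 : 0 < lam) (hlam : lam ≤ 1 / 2)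
    (H G F : ℂ → ℂ)
    (hH : H ∈ HarmonicMaps.classU2 lam)
    (hG : DifferentiableOn ℂ G HarmonicMaps.unitDisk)
    (hF : ∀ z ∈ HarmonicMaps.unitDisk, F z = H z + (starRingEnd ℂ) (G z))
    (hdil0 : HarmonicMaps.dilatation H G 0 = 0)
    (hdil : ∀ z ∈ HarmonicMaps.unitDisk,
      ‖HarmonicMaps.dilatation H G z‖ ≤ Real.sqrt ((1 - lam ^ 2) * (1 - 4 * lam ^ 2) ^ 2)) :
    HarmonicMaps.IsSensePreserving F ∧ HarmonicMaps.IsCloseToConvex F ∧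
      ∀ eps : ℂ, ‖eps‖ = 1 → ∀ z ∈ HarmonicMaps.unitDisk,
        |Complex.arg (deriv H z + eps * deriv G z)| ≤ Real.pi / 2 := by
  have hlt : ∀ z ∈ HarmonicMaps.unitDisk, ‖deriv G z‖ < (deriv H z).re := by
    intro z hz
    obtain ⟨p, u, hp, hu, e⟩ := HarmonicMaps.exists_sq_mul_deriv_eq hlam0 hH hz
    refine lt_of_le_of_lt ?_ (HarmonicMaps.sqrt_mul_norm_lt_re hlam0 hlam hp hu e)
    -- Division by zero would give dilatation `0` and no control of `G'`; but `H' = 0` forces `u =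
    -- 0`, at distance `1 > lam` from `1`.
    have hH0 : deriv H z ≠ 0 := by
      intro h0
      rw [h0, mul_zero] at e
      rw [← e, zero_sub, norm_neg, norm_one] at hu
      linarith
    have h := hdil z hz
    rwa [HarmonicMaps.dilatation, norm_div, div_le_iff₀ (norm_pos_iff.2 hH0)] at h
  have hHd : DifferentiableOn ℂ H HarmonicMaps.unitDisk := hH.1.1.1
  refine ⟨HarmonicMaps.isSensePreserving_of_norm_deriv_lt hHd hG hF fun z hz =>
      (hlt z hz).trans_le (Complex.re_le_norm _),
    HarmonicMaps.isCloseToConvex_of_norm_deriv_lt_re hHd hG hF hlt, fun eps heps z hz => ?_⟩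
  rw [Complex.abs_arg_le_pi_div_two_iff, Complex.add_re]
  have h := Complex.abs_re_le_norm (eps * deriv G z)
  rw [norm_mul, heps, one_mul] at h
  linarith [(abs_le.1 h).1, hlt z hz]
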